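/- Define the integers $p_{1,3}(n)$, $n\ge 0$, by $$\sum_{n=0}^{\infty}p_{1,3}(n)q^{n}=\frac{1}{(q;q)_\infty^{6}},\qquad (q;q)_\infty=\prod_{m=1}^{\infty}(1-q^{m}).$$ Then for all integers $n\geq 0$ and $\alpha\geq 1$, \begin{align*} p_{1,3}\left(3^{2\alpha-1}n+\frac{3^{2\alpha-1}+1}{4}\right) &\equiv 0 \pmod{3^{2\alpha-1}},\\ p_{1,3}\left(3^{2\alpha+1}n+\frac{7\cdot 3^{2\alpha}+1}{4}\right) &\equiv 0 \pmod{3^{2\alpha+3}},\\ p_{1,3}\left(3^{2\alpha+1}n+\frac{11\cdot 3^{2\alpha}+1}{4}\right) &\equiv 0 \pmod{3^{2\alpha+4}},\\ p_{1,3}\left(3^{2\alpha}n+\frac{5\cdot 3^{2\alpha-1}+1}{4}\right) &\equiv 0 \pmod{3^{2\alpha}},\\ p_{1,3}\left(3^{2\alpha}n+\frac{3^{2\alpha+1}+1}{4}\right) &\equiv 0 \pmod{3^{2\alpha+1}}. \end{align*} -/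

import Mathlib

open PowerSeries in
open scoped PowerSeries.WithPiTopology in
/-- The Euler product `E_j = (q^j; q^j)_∞ = ∏_{n ≥ 1} (1 - q^{jn})` (for `j ≥ 1`), as a formal power
series over `ℤ`; the infinite product is taken in the topology of coefficientwise convergence,
`ℤ` being discrete. -/
noncomputable def eulerE (j : ℕ) : PowerSeries ℤ :=
  ∏' n : ℕ, (1 - (X : PowerSeries ℤ) ^ (j * (n + 1)))

/-- The generating function `1 / (E_1^3 E_k^3)` of 2-color partition triples (for `k ≥ 1`, when the
denominator has constant coefficient `1`). -/
noncomputable def tripleGenFun (k : ℕ) : PowerSeries ℤ :=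
  PowerSeries.invOfUnit (eulerE 1 ^ 3 * eulerE k ^ 3) 1

/-- The 2-color partition triple function `p_{k,3}(n)`. -/
noncomputable def pTriple (k n : ℕ) : ℤ :=
  PowerSeries.coeff n (tripleGenFun k)

open PowerSeries in
open scoped PowerSeries.WithPiTopology in
/-- The infinite product defining `eulerE j` converges. -/
theorem eulerE_multipliable (j : ℕ) (hj : 1 ≤ j) :
    Multipliable fun n : ℕ => 1 - (X : PowerSeries ℤ) ^ (j * (n + 1)) := by
  have h : Filter.Tendsto (fun n : ℕ => (-(X : PowerSeries ℤ) ^ (j * (n + 1))).order)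
      Filter.atTop (nhds ⊤) := by
    refine ENat.tendsto_nhds_top_iff_natCast_lt.mpr fun n ↦
      Filter.eventually_atTop.mpr ⟨n, fun m hm => ?_⟩
    rw [order_neg, order_X_pow]
    norm_cast
    nlinarith
  simpa [sub_eq_add_neg] using
    PowerSeries.WithPiTopology.multipliable_one_add_of_tendsto_order_atTop_nhds_top ℤ h

open PowerSeries in
open scoped PowerSeries.WithPiTopology in
theorem eulerE_constantCoeff (j : ℕ) (hj : 1 ≤ j) : constantCoeff (eulerE j) = 1 := by
  have hj' : j ≠ 0 := by omega
  rw [eulerE, (eulerE_multipliable j hj).map_tprod _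
    (PowerSeries.WithPiTopology.continuous_constantCoeff ℤ)]
  simp [hj']

/-- `tripleGenFun k` is the reciprocal of `E_1^3 E_k^3`. -/
theorem mul_tripleGenFun (k : ℕ) (hk : 1 ≤ k) :
    eulerE 1 ^ 3 * eulerE k ^ 3 * tripleGenFun k = 1 :=
  PowerSeries.mul_invOfUnit _ 1 (by simp [eulerE_constantCoeff, hk])

/-! Write E_k for (q^k; q^k)_∞. Triangular numbers are 0 or 1 modulo 3, so Jacobi's series for E_1³
gives E_1³ = a - c, with a = A(q³) (`cubeMain`) and c = 3qE_9³ (`cubeRest`). The norm of E_1 down to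
series in q³, computed factor by factor, is E_3⁴/E_9. Comparing it with the norm of a - c yields A³
= N(1 + T), where N = E_1¹²/E_3³ and T = 27qE_3¹²/E_1¹². Rationalising, 1/E_1³ = (a² + ac +
c²)/N(q³), and section r of a form of degree 3k + r in a, c is 3^r E_3^{3r} N^k times an element of
ℤ[T].

Put O = E_3⁶/E_1¹² and V = E_3¹²/E_1¹⁸. Section 1 of 1/E_1⁶ lies in 3O·ℤ[T], section 2 maps O·ℤ[T]
into 9V·ℤ[T], and section 0 maps V·ℤ[T] into O·ℤ[T]. Iterating (`progressionSeries_odd_even`) gives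
the first and last congruences. The other three take one more section: 27 divides T, so elements of
ℤ[T] are constants modulo 27, while O is a series in q³ modulo 3 and V has the form g₀(q³) + 9q
g₁(q³) modulo 27. This gains a further 3, 9 or 27. -/

section

open PowerSeries

/-! ### Trisection of power series -/

/-- The substitution `q ↦ q³` on integral power series. -/
noncomputable def cubeSubst : PowerSeries ℤ →+* PowerSeries ℤ :=
  (PowerSeries.expand (R := ℤ) 3 three_ne_zero).toRingHom

/-- The operator `∑ aₙ qⁿ ↦ ∑ a₃ₙ₊ᵣ qⁿ`. -/
noncomputable def trisect (r : ℕ) : PowerSeries ℤ →+ PowerSeries ℤ where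
  toFun f := PowerSeries.mk fun n => coeff (3 * n + r) f
  map_zero' := by ext; simp
  map_add' f g := by ext; simp

theorem coeff_trisect (r n : ℕ) (f : PowerSeries ℤ) :
    coeff n (trisect r f) = coeff (3 * n + r) f := by simp [trisect]

theorem coeff_cubeSubst (n : ℕ) (f : PowerSeries ℤ) :
    coeff n (cubeSubst f) = if 3 ∣ n then coeff (n / 3) f else 0 := by
  change coeff n (PowerSeries.expand 3 three_ne_zero f) = _
  rw [PowerSeries.coeff_expand]

theorem cubeSubst_X : cubeSubst X = X ^ 3 := PowerSeries.expand_X 3 three_ne_zero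

theorem trisection (f : PowerSeries ℤ) :
    f = cubeSubst (trisect 0 f) + X * cubeSubst (trisect 1 f) + X ^ 2 * cubeSubst (trisect 2 f) := by
  ext n
  rw [map_add, map_add, ← pow_one (X : PowerSeries ℤ), coeff_X_pow_mul', pow_one,
    coeff_X_pow_mul']
  simp only [coeff_cubeSubst, coeff_trisect]
  obtain ⟨k, rfl | rfl | rfl⟩ : ∃ k, n = 3 * k ∨ n = 3 * k + 1 ∨ n = 3 * k + 2 :=
    ⟨n / 3, by omega⟩
  · rw [if_pos (by omega), ite_eq_right_iff.2, ite_eq_right_iff.2]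
    · simp
    · intro _; rw [if_neg (by omega)]
    · intro _; rw [if_neg (by omega)]
  · rw [if_neg (by omega), if_pos (by omega), if_pos (by omega), ite_eq_right_iff.2]
    · simp
    · intro _; rw [if_neg (by omega)]
  · rw [if_neg (by omega), if_pos (by omega), if_neg (by omega), if_pos (by omega),
      if_pos (by omega)]
    simp

theorem trisect_of_trisection (f₀ f₁ f₂ : PowerSeries ℤ) :
    trisect 0 (cubeSubst f₀ + X * cubeSubst f₁ + X ^ 2 * cubeSubst f₂) = f₀ ∧
    trisect 1 (cubeSubst f₀ + X * cubeSubst f₁ + X ^ 2 * cubeSubst f₂) = f₁ ∧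
    trisect 2 (cubeSubst f₀ + X * cubeSubst f₁ + X ^ 2 * cubeSubst f₂) = f₂ := by
  refine ⟨?_, ?_, ?_⟩ <;> ext n <;> rw [coeff_trisect] <;>
    rw [map_add, map_add, ← pow_one (X : PowerSeries ℤ), coeff_X_pow_mul', pow_one,
      coeff_X_pow_mul'] <;> simp only [coeff_cubeSubst]
  · rw [if_pos (by omega), ite_eq_right_iff.2, ite_eq_right_iff.2]
    · simp
    · intro _; rw [if_neg (by omega)]
    · intro _; rw [if_neg (by omega)]
  · rw [if_neg (by omega), if_pos (by omega), if_pos (by omega), ite_eq_right_iff.2]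
    · simp
    · intro _; rw [if_neg (by omega)]
  · rw [if_neg (by omega), if_pos (by omega), if_neg (by omega), if_pos (by omega),
      if_pos (by omega)]
    simp

theorem trisect_cubeSubst_mul (r : ℕ) (hr : r < 3) (g f : PowerSeries ℤ) :
    trisect r (cubeSubst g * f) = g * trisect r f := by
  have h := trisect_of_trisection (g * trisect 0 f) (g * trisect 1 f) (g * trisect 2 f)
  have e : cubeSubst g * f = cubeSubst (g * trisect 0 f) + X * cubeSubst (g * trisect 1 f)
      + X ^ 2 * cubeSubst (g * trisect 2 f) := by
    conv_lhs => rw [trisection f]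
    simp only [map_mul]; ring
  rw [← e] at h
  obtain ⟨h0, h1, h2⟩ := h
  interval_cases r <;> assumption

theorem trisect_X_pow (r s : ℕ) (hr : r < 3) (hs : s < 3) :
    trisect r (X ^ s) = if r = s then 1 else 0 := by
  ext n
  rw [coeff_trisect, coeff_X_pow]
  by_cases h : r = s
  · subst h; simp only [if_true, coeff_one]; congr 1; simp
  · rw [if_neg h, if_neg (by omega)]; simp

theorem trisect_intCast_mul (r : ℕ) (z : ℤ) (f : PowerSeries ℤ) :
    trisect r ((z : PowerSeries ℤ) * f) = (z : PowerSeries ℤ) * trisect r f := by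
  rw [← zsmul_eq_mul, map_zsmul, zsmul_eq_mul]

/-! ### The norm down to series in q³ -/

/-- The norm of `f` over the subring of power series in `q³`, as a power series in `q³`. -/
noncomputable def cubeNorm (f : PowerSeries ℤ) : PowerSeries ℤ :=
  trisect 0 f ^ 3 + X * trisect 1 f ^ 3 + X ^ 2 * trisect 2 f ^ 3
    - 3 * X * trisect 0 f * trisect 1 f * trisect 2 f

theorem cubeNorm_trisection (f₀ f₁ f₂ : PowerSeries ℤ) :
    cubeNorm (cubeSubst f₀ + X * cubeSubst f₁ + X ^ 2 * cubeSubst f₂) =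
      f₀ ^ 3 + X * f₁ ^ 3 + X ^ 2 * f₂ ^ 3 - 3 * X * f₀ * f₁ * f₂ := by
  obtain ⟨h0, h1, h2⟩ := trisect_of_trisection f₀ f₁ f₂
  rw [cubeNorm, h0, h1, h2]

/-- `cubeNorm f` is the determinant of multiplication by f in the basis 1, q, q² over ℤ[[q³]],
rewritten in q; this avoids cube roots of unity. -/
theorem cubeNorm_mul (f g : PowerSeries ℤ) : cubeNorm (f * g) = cubeNorm f * cubeNorm g := by
  have e : f * g =
      cubeSubst (trisect 0 f * trisect 0 g + X * trisect 1 f * trisect 2 g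
        + X * trisect 2 f * trisect 1 g)
      + X * cubeSubst (trisect 0 f * trisect 1 g + trisect 1 f * trisect 0 g
        + X * trisect 2 f * trisect 2 g)
      + X ^ 2 * cubeSubst (trisect 0 f * trisect 2 g + trisect 1 f * trisect 1 g
        + trisect 2 f * trisect 0 g) := by
    conv_lhs => rw [trisection f, trisection g]
    simp only [map_mul, map_add, cubeSubst_X]; ring
  rw [e, cubeNorm_trisection, cubeNorm, cubeNorm]
  ring

theorem cubeNorm_pow (f : PowerSeries ℤ) (n : ℕ) : cubeNorm (f ^ n) = cubeNorm f ^ n := by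
  induction n with
  | zero =>
    have h := cubeNorm_trisection 1 0 0
    simpa using h
  | succ n ih => rw [pow_succ, cubeNorm_mul, ih, pow_succ]

theorem cubeNorm_one_sub_X_pow_three_mul (i : ℕ) :
    cubeNorm (1 - X ^ (3 * i)) = (1 - X ^ i) ^ 3 := by
  have h := cubeNorm_trisection (1 - X ^ i) 0 0
  simpa [cubeSubst_X, ← pow_mul] using h

theorem cubeNorm_one_sub_X_pow_three_mul_add_one (i : ℕ) :
    cubeNorm (1 - X ^ (3 * i + 1)) = 1 - X ^ (3 * i + 1) := by
  have h := cubeNorm_trisection 1 (- X ^ i) 0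
  simp only [map_one, map_neg, map_pow, cubeSubst_X, map_zero] at h
  rw [show (1 - X ^ (3 * i + 1) : PowerSeries ℤ) = 1 + X * -(X ^ 3) ^ i + X ^ 2 * 0 by ring, h]
  ring

theorem cubeNorm_one_sub_X_pow_three_mul_add_two (i : ℕ) :
    cubeNorm (1 - X ^ (3 * i + 2)) = 1 - X ^ (3 * i + 2) := by
  have h := cubeNorm_trisection 1 0 (- X ^ i)
  simp only [map_one, map_neg, map_pow, cubeSubst_X, map_zero] at h
  rw [show (1 - X ^ (3 * i + 2) : PowerSeries ℤ) = 1 + X * 0 + X ^ 2 * -(X ^ 3) ^ i by ring, h]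
  ring

/-! ### Approximation modulo powers of q, and the norm of the Euler product -/

theorem X_pow_dvd_trisect_sub {N r : ℕ} (hr : r < 3) {f g : PowerSeries ℤ}
    (h : X ^ (3 * N) ∣ f - g) : X ^ N ∣ trisect r f - trisect r g := by
  rw [X_pow_dvd_iff] at *
  intro m hm
  rw [← map_sub, coeff_trisect]
  exact h _ (by omega)

theorem X_pow_dvd_cubeSubst_sub {N : ℕ} {f g : PowerSeries ℤ} (h : X ^ N ∣ f - g) :
    X ^ N ∣ cubeSubst f - cubeSubst g := by
  rw [← map_sub]
  refine (pow_dvd_pow X (by omega : N ≤ 3 * N)).trans ?_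
  simpa [cubeSubst_X, pow_mul] using map_dvd cubeSubst h

theorem eq_of_forall_X_pow_dvd_sub {f g : PowerSeries ℤ} (h : ∀ N, X ^ N ∣ f - g) : f = g := by
  ext n
  have := (X_pow_dvd_iff.1 (h (n + 1))) n (by omega)
  rwa [map_sub, sub_eq_zero] at this

theorem X_pow_dvd_cubeNorm_sub {N : ℕ} {f g : PowerSeries ℤ} (h : X ^ (3 * N) ∣ f - g) :
    X ^ N ∣ cubeNorm f - cubeNorm g := by
  have h0 := X_pow_dvd_trisect_sub (r := 0) (by omega) h
  have h1 := X_pow_dvd_trisect_sub (r := 1) (by omega) h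
  have h2 := X_pow_dvd_trisect_sub (r := 2) (by omega) h
  simp only [← Ideal.mem_span_singleton, ← Ideal.Quotient.eq] at *
  simp only [cubeNorm, map_sub, map_add, map_mul, map_pow, h0, h1, h2]

/-- The finite product `(q; q)_k = ∏_{1 ≤ i ≤ k} (1 - qⁱ)`. -/
noncomputable def qPoch (k : ℕ) : PowerSeries ℤ := ∏ i ∈ Finset.range k, (1 - X ^ (i + 1))

theorem qPoch_zero : qPoch 0 = 1 := by simp [qPoch]

theorem qPoch_succ (k : ℕ) : qPoch (k + 1) = qPoch k * (1 - X ^ (k + 1)) := by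
  simp [qPoch, Finset.prod_range_succ]

theorem X_pow_dvd_qPoch_sub {k l N : ℕ} (hk : N ≤ k) (hl : N ≤ l) :
    X ^ N ∣ qPoch k - qPoch l := by
  have key : ∀ d, X ^ N ∣ qPoch (N + d) - qPoch N := by
    intro d
    induction d with
    | zero => simp
    | succ d ih =>
      rw [← add_assoc, qPoch_succ]
      have : qPoch (N + d) * (1 - X ^ (N + d + 1)) - qPoch N =
        (qPoch (N + d) - qPoch N) - X ^ N * (X ^ (d + 1) * qPoch (N + d)) := by ring
      rw [this]
      exact dvd_sub ih (dvd_mul_right _ _)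
  obtain ⟨d, rfl⟩ := Nat.exists_eq_add_of_le hk
  obtain ⟨d', rfl⟩ := Nat.exists_eq_add_of_le hl
  have := dvd_sub (key d) (key d')
  rwa [sub_sub_sub_cancel_right] at this

open scoped PowerSeries.WithPiTopology in
-- The bridge from the topological product to finite ones: limits are afterwards replaced by
-- congruences modulo `X ^ N`.
theorem X_pow_dvd_eulerE_sub_qPoch {k N : ℕ} (hk : N ≤ k) : X ^ N ∣ eulerE 1 - qPoch k := by
  rw [X_pow_dvd_iff]
  intro m hm
  have h1 := (eulerE_multipliable 1 le_rfl).hasProd.tendsto_prod_nat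
  have h2 := ((PowerSeries.WithPiTopology.continuous_coeff ℤ m).tendsto _).comp h1
  have h3 : Filter.Tendsto (fun _ : ℕ => coeff m (qPoch k)) Filter.atTop
      (nhds (coeff m (eulerE 1))) := by
    refine h2.congr' ?_
    filter_upwards [Filter.eventually_ge_atTop N] with n hn
    have := X_pow_dvd_iff.1 (X_pow_dvd_qPoch_sub hn hk) m hm
    rw [map_sub, sub_eq_zero] at this
    simpa [qPoch] using this
  rw [map_sub, sub_eq_zero]
  exact tendsto_nhds_unique h3 tendsto_const_nhds |>.symm ▸ rfl

/-- A factor 1 - q^i with 3 ∤ i is its own norm, while 1 - q^{3i} has norm (1 - q^i)³. The factor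
`cubeSubst (qPoch k)` restores the missing 1 - q^{3i}. -/
theorem cubeNorm_qPoch (k : ℕ) :
    cubeNorm (qPoch (3 * k)) * cubeSubst (qPoch k) = qPoch (3 * k) * qPoch k ^ 3 := by
  induction k with
  | zero => simpa [qPoch_zero] using cubeNorm_pow 1 0
  | succ k ih =>
    have e : qPoch (3 * (k + 1)) =
        qPoch (3 * k) * (1 - X ^ (3 * k + 1)) * (1 - X ^ (3 * k + 2)) * (1 - X ^ (3 * (k + 1))) := by
      rw [show 3 * (k + 1) = 3 * k + 1 + 1 + 1 by ring, qPoch_succ, qPoch_succ, qPoch_succ]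
    rw [e, cubeNorm_mul, cubeNorm_mul, cubeNorm_mul, cubeNorm_one_sub_X_pow_three_mul_add_one,
      cubeNorm_one_sub_X_pow_three_mul_add_two, cubeNorm_one_sub_X_pow_three_mul, qPoch_succ,
      map_mul, map_sub, map_one, map_pow, cubeSubst_X, ← pow_mul]
    linear_combination (1 - X ^ (3 * k + 1)) * (1 - X ^ (3 * k + 2)) * (1 - X ^ (k + 1)) ^ 3 *
      (1 - X ^ (3 * (k + 1))) * ih

theorem cubeNorm_eulerE : cubeNorm (eulerE 1) * cubeSubst (eulerE 1) = eulerE 1 ^ 4 := by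
  refine eq_of_forall_X_pow_dvd_sub fun N => ?_
  have h1 := X_pow_dvd_cubeNorm_sub (X_pow_dvd_eulerE_sub_qPoch (le_refl (3 * N)))
  have h2 := X_pow_dvd_cubeSubst_sub (X_pow_dvd_eulerE_sub_qPoch (le_refl N))
  have h3 := X_pow_dvd_eulerE_sub_qPoch (le_refl N)
  have h4 := X_pow_dvd_eulerE_sub_qPoch (by omega : N ≤ 3 * N)
  have h5 := congrArg (Ideal.Quotient.mk (Ideal.span {(X : PowerSeries ℤ) ^ N})) (cubeNorm_qPoch N)
  simp only [← Ideal.mem_span_singleton, ← Ideal.Quotient.eq] at *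
  simp only [map_mul, map_pow] at *
  rw [h1, h2, h5, ← h3, ← h4]
  ring

/-! ### Jacobi's identity for E_1³ from a finite triple product -/

/-- The inverse of `(q; q)_k`. -/
noncomputable def qPochInv (k : ℕ) : PowerSeries ℤ := PowerSeries.invOfUnit (qPoch k) 1

theorem constantCoeff_qPoch (k : ℕ) : constantCoeff (qPoch k) = 1 := by
  simp [qPoch, map_prod]

theorem qPoch_mul_qPochInv (k : ℕ) : qPoch k * qPochInv k = 1 :=
  PowerSeries.mul_invOfUnit _ 1 (by simp [constantCoeff_qPoch])

theorem qPochInv_eq (k : ℕ) : qPochInv k = (1 - X ^ (k + 1)) * qPochInv (k + 1) := by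
  have h := qPoch_mul_qPochInv (k + 1)
  rw [qPoch_succ] at h
  linear_combination (-qPochInv k) * h + (1 - X ^ (k + 1)) * qPochInv (k + 1) * qPoch_mul_qPochInv k

/-- The coefficient of `z^{-j} - z^{j+1}` in the expansion of
`(1 - z) ∏_{1 ≤ i ≤ m} (1 - z qⁱ) (1 - z⁻¹ qⁱ)`. -/
noncomputable def thetaCoeff (m j : ℕ) : PowerSeries ℤ :=
  if j ≤ m then
    (-1) ^ j * X ^ (j * (j + 1) / 2) * qPoch (2 * m + 1) * qPochInv (m - j) * qPochInv (m + 1 + j)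
  else 0

theorem triangle_succ (j : ℕ) : (j + 1) * (j + 1 + 1) / 2 = j * (j + 1) / 2 + (j + 1) := by
  rw [show (j + 1) * (j + 1 + 1) = j * (j + 1) + (j + 1) * 2 by ring,
    Nat.add_mul_div_right _ _ two_pos]

theorem thetaCoeff_add (i j : ℕ) : thetaCoeff (j + i) j =
    (-1) ^ j * X ^ (j * (j + 1) / 2) * qPoch (2 * (j + i) + 1) * qPochInv i *
      qPochInv (2 * j + i + 1) := by
  rw [thetaCoeff, if_pos (by omega)]
  rw [show j + i - j = i by omega, show j + i + 1 + j = 2 * j + i + 1 by omega]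

theorem thetaCoeff_of_lt {m j : ℕ} (h : m < j) : thetaCoeff m j = 0 := if_neg (by omega)

/-- Keeping the factor `1 - X ^ i` makes the formula valid at the boundary i = 0, where both sides
vanish. -/
theorem thetaCoeff_add_succ (i j : ℕ) : thetaCoeff (j + i) (j + 1) =
    (-1) ^ (j + 1) * X ^ (j * (j + 1) / 2 + (j + 1)) * qPoch (2 * (j + i) + 1) *
      ((1 - X ^ i) * qPochInv i) * qPochInv (2 * j + i + 2) := by
  rcases i with _ | i
  · rw [thetaCoeff_of_lt (by omega)]; simp
  · rw [← qPochInv_eq, show j + (i + 1) = j + 1 + i by ring, thetaCoeff_add, triangle_succ,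
      show 2 * (j + 1) + i + 1 = 2 * j + (i + 1) + 2 by ring]

/-- With b_j = z^{-j} - z^{j+1}, (z + z⁻¹) b_j = b_{j-1} + b_{j+1} and b_{-1} = -b_0; the last
relation explains the extra `thetaCoeff m 0`. -/
theorem thetaCoeff_succ_zero (m : ℕ) : thetaCoeff (m + 1) 0 =
    (1 + X ^ (2 * m + 2)) * thetaCoeff m 0 - X ^ (m + 1) * (thetaCoeff m 1 - thetaCoeff m 0) := by
  have h0 := thetaCoeff_add (m + 1) 0
  have h1 := thetaCoeff_add m 0
  have h2 := thetaCoeff_add_succ m 0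
  simp only [zero_add, mul_zero, pow_zero, one_mul, zero_mul, Nat.zero_div, pow_one] at h0 h1 h2
  rw [h0, h1, h2, show 2 * (m + 1) + 1 = 2 * m + 1 + 1 + 1 by ring, qPoch_succ (2 * m + 1 + 1),
    qPoch_succ (2 * m + 1), qPochInv_eq m, qPochInv_eq (m + 1)]
  ring

/-- Effect of the new factor (1 - zq^{m+1})(1 - z⁻¹q^{m+1}) = 1 + q^{2m+2} - q^{m+1}(z + z⁻¹). -/
theorem thetaCoeff_succ_succ (m j : ℕ) : thetaCoeff (m + 1) (j + 1) =
    (1 + X ^ (2 * m + 2)) * thetaCoeff m (j + 1)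
      - X ^ (m + 1) * (thetaCoeff m (j + 2) + thetaCoeff m j) := by
  rcases lt_trichotomy m j with h | rfl | h
  · simp only [thetaCoeff_of_lt h, thetaCoeff_of_lt (by omega : m < j + 1),
      thetaCoeff_of_lt (by omega : m < j + 2), thetaCoeff_of_lt (by omega : m + 1 < j + 1)]
    ring
  · have h0 := thetaCoeff_add 0 (m + 1)
    have h1 := thetaCoeff_add 0 m
    simp only [add_zero] at h0 h1
    rw [h0, h1, thetaCoeff_of_lt (by omega), thetaCoeff_of_lt (by omega), triangle_succ,
      show 2 * (m + 1) + 1 = 2 * m + 1 + 1 + 1 by ring, qPoch_succ (2 * m + 1 + 1),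
      qPoch_succ (2 * m + 1), qPochInv_eq (2 * m + 1), qPochInv_eq (2 * m + 1 + 1)]
    ring
  · obtain ⟨i, rfl⟩ := Nat.exists_eq_add_of_lt h
    have h0 := thetaCoeff_add (i + 1) (j + 1)
    have h1 := thetaCoeff_add i (j + 1)
    have h2 := thetaCoeff_add (i + 1) j
    have h3 := thetaCoeff_add_succ i (j + 1)
    rw [show j + 1 + (i + 1) = j + i + 1 + 1 by ring] at h0
    rw [show j + 1 + i = j + i + 1 by ring] at h1 h3
    rw [show j + (i + 1) = j + i + 1 by ring] at h2
    rw [h0, h1, h2, h3, triangle_succ, show 2 * (j + 1) + (i + 1) + 1 = 2 * j + i + 2 + 1 + 1 by ring,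
      show 2 * (j + 1) + i + 1 = 2 * j + i + 2 + 1 by ring,
      show 2 * j + (i + 1) + 1 = 2 * j + i + 2 by ring,
      show 2 * (j + 1) + i + 2 = 2 * j + i + 2 + 1 + 1 by ring,
      show 2 * (j + i + 1 + 1) + 1 = 2 * (j + i + 1) + 1 + 1 + 1 by ring, qPoch_succ (_ + 1),
      qPoch_succ (_ + 1), qPochInv_eq i, qPochInv_eq (2 * j + i + 2),
      qPochInv_eq (2 * j + i + 2 + 1)]
    ring

/-- Finite triple product divided by 1 - z, at z = 1: (z^{-j} - z^{j+1})/(1 - z) is a sum of 2j + 1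
powers of z. -/
theorem sum_odd_mul_thetaCoeff (m M : ℕ) (hM : m < M) :
    ∑ j ∈ Finset.range M, (2 * j + 1 : PowerSeries ℤ) * thetaCoeff m j = qPoch m ^ 2 := by
  induction m generalizing M with
  | zero =>
    obtain ⟨M, rfl⟩ := Nat.exists_eq_add_of_lt hM
    rw [zero_add, Finset.sum_range_succ', Finset.sum_eq_zero]
    · have h := thetaCoeff_add 0 0
      have h1 := qPoch_mul_qPochInv 1
      have h0 := qPoch_mul_qPochInv 0
      simp only [qPoch_zero, one_mul] at h0
      simp [h0, h1, qPoch_zero] at h ⊢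
      exact h
    · intro j _
      rw [thetaCoeff_of_lt (by omega), mul_zero]
  | succ m ih =>
    -- summation by parts against the sequence `2 j + 1`, whose second difference vanishes
    have key : ∀ K : ℕ, ∑ j ∈ Finset.range (K + 1), (2 * j + 1 : PowerSeries ℤ) * thetaCoeff (m + 1) j =
        (1 - X ^ (m + 1)) ^ 2 *
          ∑ j ∈ Finset.range (K + 1), (2 * j + 1 : PowerSeries ℤ) * thetaCoeff m j
        + X ^ (m + 1) * ((2 * K + 3 : PowerSeries ℤ) * thetaCoeff m K
          - (2 * K + 1 : PowerSeries ℤ) * thetaCoeff m (K + 1)) := by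
      intro K
      induction K with
      | zero => simp [thetaCoeff_succ_zero]; ring
      | succ K ihK =>
        rw [Finset.sum_range_succ, ihK, Finset.sum_range_succ _ (K + 1), thetaCoeff_succ_succ]
        push_cast
        ring
    obtain ⟨K, rfl⟩ : ∃ K, M = K + 1 := ⟨M - 1, by omega⟩
    rw [key, ih _ (by omega), thetaCoeff_of_lt (by omega : m < K),
      thetaCoeff_of_lt (by omega : m < K + 1), qPoch_succ]
    ring

/-- Partial sums of Jacobi's series `∑ (-1)^j (2j+1) q^{j(j+1)/2}`. -/
noncomputable def jacobiPartialSum (M : ℕ) : PowerSeries ℤ :=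
  ∑ j ∈ Finset.range M, (2 * j + 1 : PowerSeries ℤ) * ((-1) ^ j * X ^ (j * (j + 1) / 2))

theorem le_triangle (j : ℕ) : j ≤ j * (j + 1) / 2 := by
  induction j with
  | zero => simp
  | succ j ih => rw [triangle_succ]; omega

theorem X_pow_dvd_jacobiPartialSum_sub {N M : ℕ} (h : N ≤ M) : X ^ N ∣ jacobiPartialSum M - jacobiPartialSum N := by
  induction M, h using Nat.le_induction with
  | base => simp
  | succ M hM ih =>
    rw [jacobiPartialSum, Finset.sum_range_succ, ← jacobiPartialSum, add_sub_right_comm]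
    exact dvd_add ih (((pow_dvd_pow X (hM.trans (le_triangle M))).mul_left _).mul_left _)

/-- With m = 2N, either j ≥ N and both terms vanish modulo q^N, or all indices 2m + 1, m - j, m + 1
+ j are at least N and each `qPoch` may be replaced by E_1. -/
theorem X_pow_dvd_thetaCoeff_mul_eulerE_sub {N j : ℕ} (hj : j ≤ 2 * N) :
    X ^ N ∣ thetaCoeff (2 * N) j * eulerE 1 - (-1) ^ j * X ^ (j * (j + 1) / 2) := by
  rw [thetaCoeff, if_pos hj]
  by_cases h : N ≤ j
  · have hd : (X : PowerSeries ℤ) ^ N ∣ X ^ (j * (j + 1) / 2) :=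
      pow_dvd_pow X (h.trans (le_triangle j))
    refine dvd_sub ?_ (hd.mul_left _)
    exact ((((hd.mul_left _).mul_right _).mul_right _).mul_right _).mul_right _
  · have h1 := X_pow_dvd_eulerE_sub_qPoch (by omega : N ≤ 2 * (2 * N) + 1)
    have h2 := X_pow_dvd_eulerE_sub_qPoch (by omega : N ≤ 2 * N - j)
    have h3 := X_pow_dvd_eulerE_sub_qPoch (by omega : N ≤ 2 * N + 1 + j)
    have h4 := congrArg (Ideal.Quotient.mk (Ideal.span {(X : PowerSeries ℤ) ^ N}))
      (qPoch_mul_qPochInv (2 * N - j))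
    have h5 := congrArg (Ideal.Quotient.mk (Ideal.span {(X : PowerSeries ℤ) ^ N}))
      (qPoch_mul_qPochInv (2 * N + 1 + j))
    simp only [← Ideal.mem_span_singleton, ← Ideal.Quotient.eq] at *
    simp only [map_mul, map_pow, map_neg, map_one, ← h1, ← h2, ← h3] at *
    set φ := Ideal.Quotient.mk (Ideal.span {(X : PowerSeries ℤ) ^ N})
    linear_combination (-1) ^ j * φ X ^ (j * (j + 1) / 2) *
      (h4 + φ (eulerE 1) * φ (qPochInv (2 * N - j)) * h5)

theorem X_pow_dvd_eulerE_cube_sub_jacobiPartialSum {N M : ℕ} (h : N ≤ M) :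
    X ^ N ∣ eulerE 1 ^ 3 - jacobiPartialSum M := by
  have h1 : X ^ N ∣ qPoch (2 * N) ^ 2 * eulerE 1 - jacobiPartialSum (2 * N + 1) := by
    rw [← sum_odd_mul_thetaCoeff _ _ (Nat.lt_succ_self _), Finset.sum_mul, jacobiPartialSum,
      ← Finset.sum_sub_distrib]
    refine Finset.dvd_sum fun j hj => ?_
    rw [mul_assoc, ← mul_sub]
    exact (X_pow_dvd_thetaCoeff_mul_eulerE_sub (by simp at hj; omega)).mul_left _
  have h2 := X_pow_dvd_jacobiPartialSum_sub h
  have h3 := X_pow_dvd_jacobiPartialSum_sub (by omega : N ≤ 2 * N + 1)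
  have h4 := X_pow_dvd_eulerE_sub_qPoch (by omega : N ≤ 2 * N)
  simp only [← Ideal.mem_span_singleton, ← Ideal.Quotient.eq] at *
  rw [h2, ← h3, ← h1, map_mul, map_pow, map_pow, h4]
  ring

/-! ### Trisection of E_1³ -/

theorem exists_jacobiPartialSum_three_mul (M : ℕ) : ∃ g, jacobiPartialSum (3 * M) =
    cubeSubst g + X * cubeSubst (-3 * cubeSubst (jacobiPartialSum M)) + X ^ 2 * cubeSubst 0 := by
  induction M with
  | zero => exact ⟨0, by simp [jacobiPartialSum]⟩
  | succ M ih =>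
    obtain ⟨g, hg⟩ := ih
    refine ⟨g + (-1) ^ M * (((6 * M + 1 : ℕ) : PowerSeries ℤ) * X ^ (M * (3 * M + 1) / 2) +
      ((6 * M + 5 : ℕ) : PowerSeries ℤ) * X ^ (M * (3 * M + 1) / 2 + (2 * M + 1))), ?_⟩
    -- Indices 3M and 3M + 2 give exponents divisible by 3. Index 3M + 1 gives exponent 9·M(M+1)/2 +
    -- 1, with weight 3(2M + 1) and sign -(-1)^M: again Jacobi's series, in q⁹.
    have t0 : 3 * M * (3 * M + 1) / 2 = 3 * (M * (3 * M + 1) / 2) := by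
      obtain ⟨k, hk⟩ : 2 ∣ M * (3 * M + 1) := by
        rcases Nat.even_or_odd' M with ⟨a, rfl | rfl⟩
        · exact ⟨a * (3 * (2 * a) + 1), by ring⟩
        · exact ⟨(2 * a + 1) * (3 * a + 2), by ring⟩
      rw [mul_assoc, hk]; omega
    have t1 : (3 * M + 1) * (3 * M + 1 + 1) / 2 = 9 * (M * (M + 1) / 2) + 1 := by
      obtain ⟨k, hk⟩ := (Nat.even_mul_succ_self M).two_dvd
      rw [hk, show (3 * M + 1) * (3 * M + 1 + 1) = 9 * (M * (M + 1)) + 2 by ring, hk]; omega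
    have t2 : (3 * M + 2) * (3 * M + 2 + 1) / 2 = 3 * (M * (3 * M + 1) / 2 + (2 * M + 1)) := by
      rw [show 3 * M + 2 = 3 * M + 1 + 1 by ring, triangle_succ, triangle_succ, t0]; ring
    have s : (-1 : PowerSeries ℤ) ^ (3 * M) = (-1) ^ M := by
      rw [pow_mul]; norm_num
    rw [show 3 * (M + 1) = 3 * M + 1 + 1 + 1 by ring]
    simp only [jacobiPartialSum, Finset.sum_range_succ] at hg ⊢
    rw [hg, t0, t1, show 3 * M + 1 + 1 = 3 * M + 2 by ring, t2, pow_add _ (3 * M),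
      pow_add (-1) (3 * M), s]
    simp only [map_add, map_mul, map_neg, map_pow, cubeSubst_X, map_natCast, map_one, map_zero,
      map_ofNat]
    push_cast
    ring

theorem trisect_one_eulerE_cube : trisect 1 (eulerE 1 ^ 3) = -3 * cubeSubst (eulerE 1 ^ 3) := by
  refine eq_of_forall_X_pow_dvd_sub fun N => ?_
  have h1 := X_pow_dvd_trisect_sub (r := 1) (by omega)
    (X_pow_dvd_eulerE_cube_sub_jacobiPartialSum (le_refl (3 * N)))
  have h2 := X_pow_dvd_cubeSubst_sub (X_pow_dvd_eulerE_cube_sub_jacobiPartialSum (le_refl N))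
  obtain ⟨g, hg⟩ := exists_jacobiPartialSum_three_mul N
  rw [hg, (trisect_of_trisection _ _ _).2.1] at h1
  have := dvd_add h1 (h2.mul_left 3)
  convert this using 1
  ring

theorem trisect_two_eulerE_cube : trisect 2 (eulerE 1 ^ 3) = 0 := by
  refine eq_of_forall_X_pow_dvd_sub fun N => ?_
  have h1 := X_pow_dvd_trisect_sub (r := 2) (by omega)
    (X_pow_dvd_eulerE_cube_sub_jacobiPartialSum (le_refl (3 * N)))
  obtain ⟨g, hg⟩ := exists_jacobiPartialSum_three_mul N
  rwa [hg, (trisect_of_trisection _ _ _).2.2] at h1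

theorem eulerE_cube_trisection : eulerE 1 ^ 3 =
    cubeSubst (trisect 0 (eulerE 1 ^ 3)) - 3 * X * cubeSubst (cubeSubst (eulerE 1) ^ 3) := by
  conv_lhs => rw [trisection (eulerE 1 ^ 3), trisect_one_eulerE_cube, trisect_two_eulerE_cube]
  simp only [map_mul, map_neg, map_ofNat, map_pow, map_zero]
  ring

/-- The norm of E_1³ computed twice: from its sections, and as the cube of the norm of E_1. -/
theorem trisect_zero_eulerE_cube_pow :
    (trisect 0 (eulerE 1 ^ 3) ^ 3 - 27 * X * cubeSubst (eulerE 1) ^ 9) *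
      cubeSubst (eulerE 1) ^ 3 = eulerE 1 ^ 12 := by
  have h : cubeNorm (eulerE 1 ^ 3) =
      trisect 0 (eulerE 1 ^ 3) ^ 3 - 27 * X * cubeSubst (eulerE 1) ^ 9 := by
    rw [cubeNorm, trisect_one_eulerE_cube, trisect_two_eulerE_cube, map_pow cubeSubst]
    ring
  rw [← h, cubeNorm_pow, ← mul_pow, cubeNorm_eulerE]
  ring

/-! ### The Hauptmodul and the rationalised form of 1/E_1³ -/

/-- The reciprocal of the Euler product. -/
noncomputable def eulerInv : PowerSeries ℤ := PowerSeries.invOfUnit (eulerE 1) 1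

theorem eulerE_mul_eulerInv : eulerE 1 * eulerInv = 1 :=
  PowerSeries.mul_invOfUnit _ 1 (by simp [eulerE_constantCoeff])

theorem cubeSubst_eulerE_mul_eulerInv : cubeSubst (eulerE 1) * cubeSubst eulerInv = 1 := by
  rw [← map_mul, eulerE_mul_eulerInv, map_one]

theorem tripleGenFun_one : tripleGenFun 1 = eulerInv ^ 6 := by
  have h1 := mul_tripleGenFun 1 le_rfl
  have h2 : eulerE 1 ^ 6 * eulerInv ^ 6 = 1 := by rw [← mul_pow, eulerE_mul_eulerInv, one_pow]
  linear_combination eulerInv ^ 6 * h1 - tripleGenFun 1 * h2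

/-- The norm `E₁¹² / E₃³` of `E₁³`. -/
noncomputable def eulerCubeNorm : PowerSeries ℤ := eulerE 1 ^ 12 * cubeSubst eulerInv ^ 3

/-- The Hauptmodul `27 q E₃¹² / E₁¹²`. -/
noncomputable def hauptmodul : PowerSeries ℤ :=
  27 * X * cubeSubst (eulerE 1) ^ 12 * eulerInv ^ 12

theorem eulerCubeNorm_mul_hauptmodul :
    eulerCubeNorm * hauptmodul = 27 * X * cubeSubst (eulerE 1) ^ 9 := by
  have h1 : eulerE 1 ^ 12 * eulerInv ^ 12 = 1 := by rw [← mul_pow, eulerE_mul_eulerInv, one_pow]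
  have h2 : cubeSubst (eulerE 1) ^ 3 * cubeSubst eulerInv ^ 3 = 1 := by
    rw [← mul_pow, cubeSubst_eulerE_mul_eulerInv, one_pow]
  rw [eulerCubeNorm, hauptmodul]
  linear_combination 27 * X * cubeSubst (eulerE 1) ^ 9 * (h2 + cubeSubst (eulerE 1) ^ 3 *
    cubeSubst eulerInv ^ 3 * h1)

/-- The part of `E₁³` with exponents divisible by three, as a series in `q³`. -/
noncomputable def cubeMain : PowerSeries ℤ := trisect 0 (eulerE 1 ^ 3)

theorem cubeMain_pow_three : cubeMain ^ 3 = eulerCubeNorm * (1 + hauptmodul) := by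
  have h2 : cubeSubst (eulerE 1) ^ 3 * cubeSubst eulerInv ^ 3 = 1 := by
    rw [← mul_pow, cubeSubst_eulerE_mul_eulerInv, one_pow]
  have h3 := trisect_zero_eulerE_cube_pow
  rw [← cubeMain] at h3
  rw [mul_add, eulerCubeNorm_mul_hauptmodul, eulerCubeNorm]
  linear_combination cubeSubst eulerInv ^ 3 * h3 -
    (cubeMain ^ 3 - 27 * X * cubeSubst (eulerE 1) ^ 9) * h2

/-- The part `3 q E₉³` of `-E₁³` with exponents congruent to one modulo three. -/
noncomputable def cubeRest : PowerSeries ℤ := 3 * X * cubeSubst (cubeSubst (eulerE 1) ^ 3)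

theorem eulerE_pow_three : eulerE 1 ^ 3 = cubeSubst cubeMain - cubeRest :=
  eulerE_cube_trisection

theorem cubeRest_pow_three : cubeRest ^ 3 = cubeSubst (eulerCubeNorm * hauptmodul) := by
  rw [eulerCubeNorm_mul_hauptmodul, cubeRest]
  simp only [map_mul, map_pow, cubeSubst_X, map_ofNat]
  ring

/-- The product of the two conjugates of `E₁³`. -/
noncomputable def cubeConj : PowerSeries ℤ :=
  cubeSubst cubeMain ^ 2 + cubeSubst cubeMain * cubeRest + cubeRest ^ 2

theorem eulerE_pow_three_mul_cubeConj : eulerE 1 ^ 3 * cubeConj = cubeSubst eulerCubeNorm := by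
  have h := congrArg cubeSubst cubeMain_pow_three
  have h' := cubeRest_pow_three
  simp only [map_mul, map_add, map_one, map_pow] at h h'
  rw [eulerE_pow_three, cubeConj]
  linear_combination h - h'

/-- The `cubeSubst` factor is 1/N(q³), as E_1³ times `cubeConj` is N(q³). -/
theorem eulerInv_pow_three :
    eulerInv ^ 3 = cubeSubst (eulerInv ^ 12 * cubeSubst (eulerE 1) ^ 3) * cubeConj := by
  have h1 : eulerE 1 ^ 3 * eulerInv ^ 3 = 1 := by rw [← mul_pow, eulerE_mul_eulerInv, one_pow]
  have h : eulerCubeNorm * (eulerInv ^ 12 * cubeSubst (eulerE 1) ^ 3) = 1 := by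
    rw [eulerCubeNorm, show eulerE 1 ^ 12 * cubeSubst eulerInv ^ 3 *
      (eulerInv ^ 12 * cubeSubst (eulerE 1) ^ 3) = (eulerE 1 * eulerInv) ^ 12 *
      (cubeSubst (eulerE 1) * cubeSubst eulerInv) ^ 3 by ring, eulerE_mul_eulerInv,
      cubeSubst_eulerE_mul_eulerInv]
    ring
  have h2 := congrArg cubeSubst h
  rw [map_mul, map_one] at h2
  have h3 := eulerE_pow_three_mul_cubeConj
  generalize cubeSubst (eulerInv ^ 12 * cubeSubst (eulerE 1) ^ 3) = u at *
  linear_combination (-eulerInv ^ 3) * h2 - eulerInv ^ 3 * u * h3 + u * cubeConj * h1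

/-! ### Sections of eta quotients times polynomials in the Hauptmodul -/

/-- The ring of integral polynomials in the Hauptmodul. -/
noncomputable def hauptmodulRing : Subalgebra ℤ (PowerSeries ℤ) := Algebra.adjoin ℤ {hauptmodul}

theorem hauptmodul_mem : hauptmodul ∈ hauptmodulRing := Algebra.self_mem_adjoin_singleton _ _

/-- Both a³ and c³ are N(q³) times a polynomial in T(q³), so l mod 3 alone decides the surviving
section. If l ≡ r then 3 ∣ i, and the leftover c^r supplies 3^r E_3^{3r}. -/
theorem trisect_monomial (r : ℕ) (hr : r < 3) (k i l : ℕ) (h : i + l = 3 * k + r) :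
    ∃ p ∈ hauptmodulRing, trisect r (cubeSubst cubeMain ^ i * cubeRest ^ l) =
      3 ^ r * cubeSubst (eulerE 1) ^ (3 * r) * eulerCubeNorm ^ k * p := by
  obtain ⟨m, s, hs, rfl⟩ : ∃ m s, s < 3 ∧ l = 3 * m + s := ⟨l / 3, l % 3, by omega, by omega⟩
  have e : cubeSubst cubeMain ^ i * cubeRest ^ (3 * m + s) =
      cubeSubst (cubeMain ^ i * (eulerCubeNorm * hauptmodul) ^ m * 3 ^ s *
        (cubeSubst (eulerE 1) ^ 3) ^ s) * X ^ s := by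
    rw [pow_add, pow_mul cubeRest, cubeRest_pow_three, cubeRest]
    simp only [map_mul, map_pow, map_ofNat]
    ring
  rw [e, trisect_cubeSubst_mul r hr, trisect_X_pow r s hr hs]
  split_ifs with hrs
  · subst hrs
    obtain ⟨j, rfl⟩ : ∃ j, i = 3 * j := ⟨i / 3, by omega⟩
    refine ⟨(1 + hauptmodul) ^ j * hauptmodul ^ m,
      mul_mem (pow_mem (add_mem (one_mem _) hauptmodul_mem) _) (pow_mem hauptmodul_mem _), ?_⟩
    obtain rfl : k = j + m := by omega
    rw [pow_mul, cubeMain_pow_three, mul_pow eulerCubeNorm (1 + _)]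
    ring
  · exact ⟨0, zero_mem _, by simp⟩

theorem trisect_monomial_mul_cubeConj (r : ℕ) (hr : r < 3) (k n i l : ℕ)
    (h : i + l + 2 * n = 3 * k + r) :
    ∃ p ∈ hauptmodulRing, trisect r (cubeSubst cubeMain ^ i * cubeRest ^ l * cubeConj ^ n) =
      3 ^ r * cubeSubst (eulerE 1) ^ (3 * r) * eulerCubeNorm ^ k * p := by
  induction n generalizing i l with
  | zero => simpa using trisect_monomial r hr k i l (by omega)
  | succ n ih =>
    obtain ⟨p₁, h₁, e₁⟩ := ih (i + 2) l (by omega)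
    obtain ⟨p₂, h₂, e₂⟩ := ih (i + 1) (l + 1) (by omega)
    obtain ⟨p₃, h₃, e₃⟩ := ih i (l + 2) (by omega)
    refine ⟨p₁ + p₂ + p₃, add_mem (add_mem h₁ h₂) h₃, ?_⟩
    have e : cubeSubst cubeMain ^ i * cubeRest ^ l * cubeConj ^ (n + 1) =
        cubeSubst cubeMain ^ (i + 2) * cubeRest ^ l * cubeConj ^ n +
        cubeSubst cubeMain ^ (i + 1) * cubeRest ^ (l + 1) * cubeConj ^ n +
        cubeSubst cubeMain ^ i * cubeRest ^ (l + 2) * cubeConj ^ n := by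
      have hc : cubeConj = cubeSubst cubeMain ^ 2 + cubeSubst cubeMain * cubeRest + cubeRest ^ 2 :=
        rfl
      linear_combination cubeSubst cubeMain ^ i * cubeRest ^ l * cubeConj ^ n * hc
    rw [e, map_add, map_add, e₁, e₂, e₃]
    ring

/-- Action of trisection on `E₃^{6s} T^j / E₁^{6s+6}` for the Hauptmodul `T`. -/
theorem trisect_eulerQuotient_mul_hauptmodul_pow (s r j k : ℕ) (hr : r < 3)
    (h : 4 + 4 * s + 9 * j = 3 * k + r) :
    ∃ p ∈ hauptmodulRing,
      trisect r (cubeSubst (eulerE 1) ^ (6 * s) * eulerInv ^ (6 * s + 6) * hauptmodul ^ j) =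
      3 ^ r * cubeSubst (eulerE 1) ^ (3 * r) * eulerCubeNorm ^ k *
      (eulerE 1 ^ (6 * s + 12 * j) * (eulerInv ^ 12 * cubeSubst (eulerE 1) ^ 3) ^ (2 + 2 * s + 4 * j)
        * cubeSubst eulerInv ^ (3 * j)) * p := by
  -- The exponent of 1/E_1³ is 2s + 2 from the eta quotient plus 4j from T^j. Splitting 27^j q^j =
  -- 9^j (3q)^j supplies c^j up to a power of E_9, so the total degree is j + 2(2 + 2s + 4j).
  obtain ⟨p, hp, e⟩ := trisect_monomial_mul_cubeConj r hr k (2 + 2 * s + 4 * j) 0 j (by omega)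
  refine ⟨9 ^ j * p, mul_mem (pow_mem (ofNat_mem _ 9) _) hp, ?_⟩
  have e2 : cubeSubst (eulerE 1) ^ (6 * s) * eulerInv ^ (6 * s + 6) * hauptmodul ^ j =
      cubeSubst (9 ^ j * (eulerE 1 ^ (6 * s + 12 * j) *
        (eulerInv ^ 12 * cubeSubst (eulerE 1) ^ 3) ^ (2 + 2 * s + 4 * j)
        * cubeSubst eulerInv ^ (3 * j))) *
      (cubeSubst cubeMain ^ 0 * cubeRest ^ j * cubeConj ^ (2 + 2 * s + 4 * j)) := by
    have h1 : (cubeSubst (cubeSubst (eulerE 1)) * cubeSubst (cubeSubst eulerInv)) ^ (3 * j) = 1 := by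
      rw [← map_mul, cubeSubst_eulerE_mul_eulerInv, map_one, one_pow]
    have h2 : eulerInv ^ (6 * s + 6) * eulerInv ^ (12 * j) =
        (cubeSubst (eulerInv ^ 12 * cubeSubst (eulerE 1) ^ 3)) ^ (2 + 2 * s + 4 * j) *
          cubeConj ^ (2 + 2 * s + 4 * j) := by
      rw [← mul_pow, ← eulerInv_pow_three]; ring
    calc _ = cubeSubst (eulerE 1) ^ (6 * s) * (27 * X * cubeSubst (eulerE 1) ^ 12) ^ j *
          (eulerInv ^ (6 * s + 6) * eulerInv ^ (12 * j)) *
          (cubeSubst (cubeSubst (eulerE 1)) * cubeSubst (cubeSubst eulerInv)) ^ (3 * j) := by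
          rw [h1, hauptmodul]; ring
      _ = _ := by
          have h27 : (27 : PowerSeries ℤ) ^ j = 9 ^ j * 3 ^ j := by rw [← mul_pow]; norm_num
          rw [h2, cubeRest, mul_assoc 27, mul_pow 27, h27]
          generalize eulerInv ^ 12 * cubeSubst (eulerE 1) ^ 3 = u
          simp only [map_mul, map_pow, map_ofNat]
          ring
  rw [e2, trisect_cubeSubst_mul r hr, e]
  ring

/-- The eta quotient `E₃⁶ / E₁¹²`. -/
noncomputable def oddQuotient : PowerSeries ℤ := cubeSubst (eulerE 1) ^ 6 * eulerInv ^ 12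

/-- The eta quotient `E₃¹² / E₁¹⁸`. -/
noncomputable def evenQuotient : PowerSeries ℤ := cubeSubst (eulerE 1) ^ 12 * eulerInv ^ 18

theorem trisect_one_tripleGenFun :
    ∃ p ∈ hauptmodulRing, trisect 1 (tripleGenFun 1) = 3 * (oddQuotient * p) := by
  obtain ⟨p, hp, e⟩ := trisect_eulerQuotient_mul_hauptmodul_pow 0 1 0 1 (by omega) (by omega)
  refine ⟨p, hp, ?_⟩
  rw [tripleGenFun_one]
  calc _ = trisect 1 (cubeSubst (eulerE 1) ^ (6 * 0) * eulerInv ^ (6 * 0 + 6) * hauptmodul ^ 0) := by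
        simp
    _ = _ := e
    _ = 3 * (oddQuotient * p) * (eulerE 1 * eulerInv) ^ 12 *
        (cubeSubst (eulerE 1) * cubeSubst eulerInv) ^ 3 := by
      rw [eulerCubeNorm, oddQuotient]; ring
    _ = _ := by rw [eulerE_mul_eulerInv, cubeSubst_eulerE_mul_eulerInv]; ring

theorem trisect_two_oddQuotient_mul_hauptmodul_pow (j : ℕ) :
    ∃ p ∈ hauptmodulRing, trisect 2 (oddQuotient * hauptmodul ^ j) = 9 * (evenQuotient * p) := by
  obtain ⟨p, hp, e⟩ :=
    trisect_eulerQuotient_mul_hauptmodul_pow 1 2 j (3 * j + 2) (by omega) (by omega)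
  refine ⟨p, hp, ?_⟩
  calc _ = _ := e
    _ = 9 * (evenQuotient * p) * (eulerE 1 * eulerInv) ^ (48 * j + 30) *
        (cubeSubst (eulerE 1) * cubeSubst eulerInv) ^ (12 * j + 6) := by
      rw [eulerCubeNorm, evenQuotient]; ring
    _ = _ := by rw [eulerE_mul_eulerInv, cubeSubst_eulerE_mul_eulerInv]; ring

theorem trisect_zero_evenQuotient_mul_hauptmodul_pow (j : ℕ) :
    ∃ p ∈ hauptmodulRing, trisect 0 (evenQuotient * hauptmodul ^ j) = oddQuotient * p := by
  obtain ⟨p, hp, e⟩ :=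
    trisect_eulerQuotient_mul_hauptmodul_pow 2 0 j (3 * j + 4) (by omega) (by omega)
  refine ⟨p, hp, ?_⟩
  calc _ = _ := e
    _ = oddQuotient * p * (eulerE 1 * eulerInv) ^ (48 * j + 60) *
        (cubeSubst (eulerE 1) * cubeSubst eulerInv) ^ (12 * j + 12) := by
      rw [eulerCubeNorm, oddQuotient]; ring
    _ = _ := by rw [eulerE_mul_eulerInv, cubeSubst_eulerE_mul_eulerInv]; ring

theorem hauptmodulRing_induction {motive : PowerSeries ℤ → Prop}
    (add : ∀ f g, motive f → motive g → motive (f + g))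
    (pow : ∀ (z : ℤ) (j : ℕ), motive ((z : PowerSeries ℤ) * hauptmodul ^ j))
    {p : PowerSeries ℤ} (hp : p ∈ hauptmodulRing) : motive p := by
  rw [hauptmodulRing, Algebra.adjoin_singleton_eq_range_aeval] at hp
  obtain ⟨P, rfl⟩ := hp
  induction P using Polynomial.induction_on' with
  | add P Q hP hQ => simpa using add _ _ hP hQ
  | monomial n a => simpa [Polynomial.aeval_monomial] using pow a n

theorem trisect_two_oddQuotient_mul {p : PowerSeries ℤ} (hp : p ∈ hauptmodulRing) :
    ∃ p' ∈ hauptmodulRing, trisect 2 (oddQuotient * p) = 9 * (evenQuotient * p') := by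
  refine hauptmodulRing_induction
    (motive := fun p => ∃ p' ∈ hauptmodulRing, trisect 2 (oddQuotient * p) = 9 * (evenQuotient * p')) ?_ ?_ hp
  · rintro f g ⟨p, hp, e⟩ ⟨p', hp', e'⟩
    exact ⟨p + p', add_mem hp hp', by rw [mul_add, map_add, e, e']; ring⟩
  · intro z j
    obtain ⟨p, hp, e⟩ := trisect_two_oddQuotient_mul_hauptmodul_pow j
    exact ⟨z * p, mul_mem (intCast_mem _ z) hp,
      by rw [mul_left_comm, trisect_intCast_mul, e]; ring⟩

theorem trisect_zero_evenQuotient_mul {p : PowerSeries ℤ} (hp : p ∈ hauptmodulRing) :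
    ∃ p' ∈ hauptmodulRing, trisect 0 (evenQuotient * p) = oddQuotient * p' := by
  refine hauptmodulRing_induction
    (motive := fun p => ∃ p' ∈ hauptmodulRing, trisect 0 (evenQuotient * p) = oddQuotient * p') ?_ ?_ hp
  · rintro f g ⟨p, hp, e⟩ ⟨p', hp', e'⟩
    exact ⟨p + p', add_mem hp hp', by rw [mul_add, map_add, e, e']; ring⟩
  · intro z j
    obtain ⟨p, hp, e⟩ := trisect_zero_evenQuotient_mul_hauptmodul_pow j
    exact ⟨z * p, mul_mem (intCast_mem _ z) hp,
      by rw [mul_left_comm, trisect_intCast_mul, e]; ring⟩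

/-! ### Reduction modulo 3 and 27 -/

theorem exists_eq_intCast_add {p : PowerSeries ℤ} (hp : p ∈ hauptmodulRing) :
    ∃ (z : ℤ) (g : PowerSeries ℤ), p = z + 27 * g := by
  refine hauptmodulRing_induction
    (motive := fun p => ∃ (z : ℤ) (g : PowerSeries ℤ), p = z + 27 * g) ?_ ?_ hp
  · rintro f g ⟨z, p, rfl⟩ ⟨z', p', rfl⟩
    exact ⟨z + z', p + p', by push_cast; ring⟩
  · intro z j
    rcases j with _ | j
    · exact ⟨z, 0, by simp⟩
    · exact ⟨0, (z : PowerSeries ℤ) * (X * cubeSubst (eulerE 1) ^ 12 * eulerInv ^ 12) *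
        hauptmodul ^ j, by
        have e : hauptmodul = 27 * X * cubeSubst (eulerE 1) ^ 12 * eulerInv ^ 12 := rfl
        push_cast
        linear_combination (z : PowerSeries ℤ) * hauptmodul ^ j * e⟩

theorem oddQuotient_eq_cubeSubst_add : ∃ g h : PowerSeries ℤ,
    oddQuotient = cubeSubst g + 3 * h := by
  -- Since 3 ∣ c, `cubeConj` ≡ a² modulo 3. The remainder comes from x⁴ - y⁴ = (x - y)(x + y)(x² +
  -- y²) with x = `cubeConj`, y = a².
  refine ⟨eulerE 1 ^ 6 * (eulerInv ^ 12 * cubeSubst (eulerE 1) ^ 3) ^ 4 * cubeMain ^ 8,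
    cubeSubst (eulerE 1) ^ 6 * cubeSubst (eulerInv ^ 12 * cubeSubst (eulerE 1) ^ 3) ^ 4 *
    (X * cubeSubst (cubeSubst (eulerE 1) ^ 3)) * (cubeSubst cubeMain + cubeRest) *
    (cubeConj + cubeSubst cubeMain ^ 2) * (cubeConj ^ 2 + cubeSubst cubeMain ^ 4), ?_⟩
  have e : oddQuotient = cubeSubst (eulerE 1) ^ 6 * (eulerInv ^ 3) ^ 4 := by
    rw [oddQuotient]; ring
  rw [e, eulerInv_pow_three]
  have hc : cubeConj = cubeSubst cubeMain ^ 2 + 3 * (X * cubeSubst (cubeSubst (eulerE 1) ^ 3)) *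
      (cubeSubst cubeMain + cubeRest) := by
    rw [cubeConj, cubeRest]; ring
  simp only [map_mul cubeSubst (_ * _) (cubeMain ^ 8), map_mul cubeSubst (eulerE 1 ^ 6),
    map_pow cubeSubst (_ * _) 4, map_pow cubeSubst cubeMain, map_pow cubeSubst (eulerE 1) 6]
  generalize cubeSubst (eulerInv ^ 12 * cubeSubst (eulerE 1) ^ 3) = u
  linear_combination cubeSubst (eulerE 1) ^ 6 * u ^ 4 * (cubeConj + cubeSubst cubeMain ^ 2) *
    (cubeConj ^ 2 + cubeSubst cubeMain ^ 4) * hc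

theorem evenQuotient_eq_cubeSubst_add : ∃ g₀ g₁ h : PowerSeries ℤ,
    evenQuotient = cubeSubst g₀ + 9 * X * cubeSubst g₁ + 27 * h := by
  have e : evenQuotient = cubeSubst (eulerE 1) ^ 12 *
      cubeSubst (eulerInv ^ 12 * cubeSubst (eulerE 1) ^ 3) ^ 6 * cubeConj ^ 6 := by
    rw [mul_assoc, ← mul_pow, ← eulerInv_pow_three, evenQuotient]; ring
  obtain ⟨h, hc⟩ : ∃ h, cubeConj ^ 6 = cubeSubst cubeMain ^ 12 +
      9 * X * (2 * cubeSubst cubeMain ^ 11 * cubeSubst (cubeSubst (eulerE 1) ^ 3)) + 27 * h := by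
    -- The coefficients of (1 + t + t²)⁶ begin 1, 6, 21, 50. As c = 3qE_9³, the linear term carries
    -- 6·3 = 9·2, the quadratic one 21·9 = 27·7, and c³ is divisible by 27.
    refine ⟨7 * X ^ 2 * cubeSubst cubeMain ^ 10 * cubeSubst (cubeSubst (eulerE 1) ^ 3) ^ 2 +
        X ^ 3 * cubeSubst (cubeSubst (eulerE 1) ^ 3) ^ 3 * (50 * cubeSubst cubeMain ^ 9 +
          90 * cubeSubst cubeMain ^ 8 * cubeRest + 126 * cubeSubst cubeMain ^ 7 * cubeRest ^ 2 +
          141 * cubeSubst cubeMain ^ 6 * cubeRest ^ 3 + 126 * cubeSubst cubeMain ^ 5 * cubeRest ^ 4 +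
          90 * cubeSubst cubeMain ^ 4 * cubeRest ^ 5 + 50 * cubeSubst cubeMain ^ 3 * cubeRest ^ 6 +
          21 * cubeSubst cubeMain ^ 2 * cubeRest ^ 7 + 6 * cubeSubst cubeMain * cubeRest ^ 8 +
          cubeRest ^ 9), ?_⟩
    rw [cubeConj, cubeRest]; ring
  refine ⟨eulerE 1 ^ 12 * (eulerInv ^ 12 * cubeSubst (eulerE 1) ^ 3) ^ 6 * cubeMain ^ 12,
    eulerE 1 ^ 12 * (eulerInv ^ 12 * cubeSubst (eulerE 1) ^ 3) ^ 6 * (2 * cubeMain ^ 11 *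
      cubeSubst (eulerE 1) ^ 3),
    cubeSubst (eulerE 1) ^ 12 * cubeSubst (eulerInv ^ 12 * cubeSubst (eulerE 1) ^ 3) ^ 6 * h, ?_⟩
  rw [e, hc]
  simp only [map_mul, map_pow, map_ofNat]
  ring

theorem three_dvd_trisect_one_oddQuotient_mul {p : PowerSeries ℤ} (hp : p ∈ hauptmodulRing) :
    3 ∣ trisect 1 (oddQuotient * p) := by
  obtain ⟨z, f, rfl⟩ := exists_eq_intCast_add hp
  obtain ⟨g, h, e⟩ := oddQuotient_eq_cubeSubst_add
  have e' : oddQuotient * ((z : PowerSeries ℤ) + 27 * f) =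
      cubeSubst ((z : PowerSeries ℤ) * g) + X * cubeSubst 0 + X ^ 2 * cubeSubst 0 +
        ((3 : ℤ) : PowerSeries ℤ) * (9 * oddQuotient * f + (z : PowerSeries ℤ) * h) := by
    push_cast
    simp only [map_mul, map_intCast, map_zero]
    linear_combination (z : PowerSeries ℤ) * e
  rw [e', map_add, trisect_intCast_mul, (trisect_of_trisection _ _ _).2.1, zero_add]
  exact dvd_mul_of_dvd_left (by simp) _

theorem trisect_evenQuotient_mul {p : PowerSeries ℤ} (hp : p ∈ hauptmodulRing) :
    9 ∣ trisect 1 (evenQuotient * p) ∧ 27 ∣ trisect 2 (evenQuotient * p) := by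
  obtain ⟨z, f, rfl⟩ := exists_eq_intCast_add hp
  obtain ⟨g₀, g₁, h, e⟩ := evenQuotient_eq_cubeSubst_add
  have e' : evenQuotient * ((z : PowerSeries ℤ) + 27 * f) =
      cubeSubst ((z : PowerSeries ℤ) * g₀) + X * cubeSubst (9 * ((z : PowerSeries ℤ) * g₁)) + X ^ 2 * cubeSubst 0 +
        ((27 : ℤ) : PowerSeries ℤ) * (evenQuotient * f + (z : PowerSeries ℤ) * h) := by
    push_cast
    simp only [map_mul, map_intCast, map_zero, map_ofNat]
    linear_combination (z : PowerSeries ℤ) * e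
  rw [e', map_add (trisect 1) (_ + _ + _), map_add (trisect 2) (_ + _ + _), trisect_intCast_mul, trisect_intCast_mul,
    (trisect_of_trisection _ _ _).2.1, (trisect_of_trisection _ _ _).2.2, zero_add]
  refine ⟨dvd_add (dvd_mul_right _ _) (dvd_mul_of_dvd_left ⟨3, by norm_num⟩ _),
    dvd_mul_of_dvd_left (by simp) _⟩

/-! ### Iteration along the arithmetic progressions -/

/-- The generating function of `p_{1,3}` along the progression `a n + b`. -/
noncomputable def progressionSeries (a b : ℕ) : PowerSeries ℤ :=
  PowerSeries.mk fun n => pTriple 1 (a * n + b)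

theorem trisect_progressionSeries (r a b : ℕ) :
    trisect r (progressionSeries a b) = progressionSeries (3 * a) (a * r + b) := by
  ext n
  simp only [coeff_trisect, progressionSeries, coeff_mk]
  congr 1; ring

theorem trisect_three_pow_mul (r k : ℕ) (f : PowerSeries ℤ) :
    trisect r (3 ^ k * f) = 3 ^ k * trisect r f := by
  simpa using trisect_intCast_mul r (3 ^ k) f

theorem four_dvd_three_pow_odd_add_one (α : ℕ) : 4 ∣ 3 ^ (2 * α + 1) + 1 := by
  induction α with
  | zero => norm_num
  | succ α ih => rw [show 2 * (α + 1) + 1 = 2 * α + 1 + 2 by ring, pow_add]; omega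

/-- Passing from O to V gains 9 and returning gains nothing. Section 2 moves the offset by
2·3^{2α+1}, section 0 leaves it fixed. -/
theorem progressionSeries_odd_even (α : ℕ) :
    (∃ p ∈ hauptmodulRing, progressionSeries (3 ^ (2 * α + 1)) ((3 ^ (2 * α + 1) + 1) / 4) =
      3 ^ (2 * α + 1) * (oddQuotient * p)) ∧
    (∃ p ∈ hauptmodulRing, progressionSeries (3 ^ (2 * α + 2)) ((3 ^ (2 * α + 3) + 1) / 4) =
      3 ^ (2 * α + 3) * (evenQuotient * p)) := by
  have even : ∀ α, (∃ p ∈ hauptmodulRing,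
      progressionSeries (3 ^ (2 * α + 1)) ((3 ^ (2 * α + 1) + 1) / 4) =
        3 ^ (2 * α + 1) * (oddQuotient * p)) →
      (∃ p ∈ hauptmodulRing, progressionSeries (3 ^ (2 * α + 2)) ((3 ^ (2 * α + 3) + 1) / 4) =
        3 ^ (2 * α + 3) * (evenQuotient * p)) := by
    rintro α ⟨p, hp, e⟩
    obtain ⟨p', hp', e'⟩ := trisect_two_oddQuotient_mul hp
    refine ⟨p', hp', ?_⟩
    have h := congrArg (trisect 2) e
    rw [trisect_progressionSeries, trisect_three_pow_mul, e'] at h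
    have h4 := four_dvd_three_pow_odd_add_one α
    rw [show (3 ^ (2 * α + 3) + 1) / 4 = 3 ^ (2 * α + 1) * 2 + (3 ^ (2 * α + 1) + 1) / 4 by
      rw [show 2 * α + 3 = 2 * α + 1 + 2 by ring, pow_add]; omega,
      show 3 ^ (2 * α + 2) = 3 * 3 ^ (2 * α + 1) by ring, h]
    ring
  induction α with
  | zero =>
    have : ∃ p ∈ hauptmodulRing,
        progressionSeries (3 ^ (2 * 0 + 1)) ((3 ^ (2 * 0 + 1) + 1) / 4) =
        3 ^ (2 * 0 + 1) * (oddQuotient * p) := by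
      obtain ⟨p, hp, e⟩ := trisect_one_tripleGenFun
      refine ⟨p, hp, ?_⟩
      simp only [mul_zero, zero_add, pow_one, ← e]
      ext n
      simp [progressionSeries, pTriple, coeff_trisect]
    exact ⟨this, even 0 this⟩
  | succ α ih =>
    obtain ⟨p, hp, e⟩ := ih.2
    obtain ⟨p', hp', e'⟩ := trisect_zero_evenQuotient_mul hp
    have h := congrArg (trisect 0) e
    rw [trisect_progressionSeries, trisect_three_pow_mul, e'] at h
    have : ∃ p ∈ hauptmodulRing,
        progressionSeries (3 ^ (2 * (α + 1) + 1)) ((3 ^ (2 * (α + 1) + 1) + 1) / 4) =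
        3 ^ (2 * (α + 1) + 1) * (oddQuotient * p) := by
      refine ⟨p', hp', ?_⟩
      rw [show 2 * (α + 1) + 1 = 2 * α + 3 by ring, ← h, mul_zero, zero_add,
        show 3 * 3 ^ (2 * α + 2) = 3 ^ (2 * α + 3) by ring]
    exact ⟨this, even _ this⟩

theorem pTriple_modEq_zero {a b k : ℕ} (h : 3 ^ k ∣ progressionSeries a b) (n : ℕ) :
    pTriple 1 (a * n + b) ≡ 0 [ZMOD 3 ^ k] := by
  obtain ⟨f, e⟩ := h
  rw [Int.modEq_zero_iff_dvd]
  have e' := congrArg (coeff n) e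
  rw [progressionSeries, coeff_mk, show (3 : PowerSeries ℤ) ^ k = C ((3 : ℤ) ^ k) by simp,
    coeff_C_mul] at e'
  exact ⟨_, e'⟩

end

theorem theorem1 (n α : ℕ) (hα : 1 ≤ α) :
    pTriple 1 (3 ^ (2 * α - 1) * n + (3 ^ (2 * α - 1) + 1) / 4) ≡ 0 [ZMOD 3 ^ (2 * α - 1)] ∧
    pTriple 1 (3 ^ (2 * α + 1) * n + (7 * 3 ^ (2 * α) + 1) / 4) ≡ 0 [ZMOD 3 ^ (2 * α + 3)] ∧
    pTriple 1 (3 ^ (2 * α + 1) * n + (11 * 3 ^ (2 * α) + 1) / 4) ≡ 0 [ZMOD 3 ^ (2 * α + 4)] ∧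
    pTriple 1 (3 ^ (2 * α) * n + (5 * 3 ^ (2 * α - 1) + 1) / 4) ≡ 0 [ZMOD 3 ^ (2 * α)] ∧
    pTriple 1 (3 ^ (2 * α) * n + (3 ^ (2 * α + 1) + 1) / 4) ≡ 0 [ZMOD 3 ^ (2 * α + 1)] := by
  obtain ⟨β, rfl⟩ : ∃ β, α = β + 1 := ⟨α - 1, by omega⟩
  obtain ⟨⟨p, hp, e⟩, ⟨p', hp', e'⟩⟩ := progressionSeries_odd_even β
  have h4 := four_dvd_three_pow_odd_add_one β
  have x2 : 3 ^ (2 * β + 2) = 3 * 3 ^ (2 * β + 1) := by ring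
  have x3 : 3 ^ (2 * β + 3) = 9 * 3 ^ (2 * β + 1) := by ring
  rw [show 2 * (β + 1) - 1 = 2 * β + 1 by omega, show 2 * (β + 1) + 1 = 2 * β + 3 by ring,
    show 2 * (β + 1) + 3 = 2 * β + 5 by ring, show 2 * (β + 1) + 4 = 2 * β + 6 by ring,
    show 2 * (β + 1) = 2 * β + 2 by ring]
  have h1 := congrArg (trisect 1) e
  have h1' := congrArg (trisect 1) e'
  have h2' := congrArg (trisect 2) e'
  rw [trisect_progressionSeries, trisect_three_pow_mul] at h1 h1' h2'
  obtain ⟨d1, d2⟩ := trisect_evenQuotient_mul hp'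
  -- The new offsets come from 5 = 4 + 1 and, below, from 7 = 4 + 3 and 11 = 8 + 3, over the
  -- denominator 4.
  rw [show 3 * 3 ^ (2 * β + 1) = 3 ^ (2 * β + 2) by ring, show 3 ^ (2 * β + 1) * 1 +
    (3 ^ (2 * β + 1) + 1) / 4 = (5 * 3 ^ (2 * β + 1) + 1) / 4 by omega] at h1
  rw [show 3 * 3 ^ (2 * β + 2) = 3 ^ (2 * β + 3) by ring] at h1' h2'
  rw [show 3 ^ (2 * β + 2) * 1 + (3 ^ (2 * β + 3) + 1) / 4 =
    (7 * 3 ^ (2 * β + 2) + 1) / 4 by omega] at h1'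
  rw [show 3 ^ (2 * β + 2) * 2 + (3 ^ (2 * β + 3) + 1) / 4 =
    (11 * 3 ^ (2 * β + 2) + 1) / 4 by omega] at h2'
  refine ⟨pTriple_modEq_zero ⟨_, e⟩ n, pTriple_modEq_zero ?_ n, pTriple_modEq_zero ?_ n,
    pTriple_modEq_zero ?_ n, pTriple_modEq_zero ⟨_, e'⟩ n⟩
  · rw [h1', show (3 : PowerSeries ℤ) ^ (2 * β + 5) = 3 ^ (2 * β + 3) * 9 by ring]
    exact mul_dvd_mul_left _ d1
  · rw [h2', show (3 : PowerSeries ℤ) ^ (2 * β + 6) = 3 ^ (2 * β + 3) * 27 by ring]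
    exact mul_dvd_mul_left _ d2
  · rw [h1, show (3 : PowerSeries ℤ) ^ (2 * β + 2) = 3 ^ (2 * β + 1) * 3 by ring]
    exact mul_dvd_mul_left _ (three_dvd_trisect_one_oddQuotient_mul hp)
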